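/- Let $d\ge 1$. A Cantor set in $\mathbb{R}^d$ is a non-empty compact, totally disconnected and perfect subset of $\mathbb{R}^d$. Let $C^1(\mathbb{R}^d)$ be the set of continuously differentiable maps $\mathbb{R}^d\to\mathbb{R}^d$, write $J_g(x)=(\partial g_i/\partial x_j(x))_{i,j}$ for the Jacobian matrix of $g$, $\|\cdot\|_F$ for the Frobenius norm of matrices and $|\cdot|$ for the Euclidean norm, and let $C^1_{\mathsf{inv}}(\mathbb{R}^d)$ be the set of $g\in C^1(\mathbb{R}^d)$ such that $J_g(x)$ is invertible for every $x\in\mathbb{R}^d$. For $f\in C^1(\mathbb{R}^d)$, $x_0\in\mathbb{R}^d$, $\delta\in(0,1)$ and $\eta>0$ let $\mathcal{G}_{f,x_0,\delta,\eta}$ be the set of all $g\in C^1(\mathbb{R}^d)$ such that $$\|J_g(x_0)-J_f(x_0)\|_F<\delta,\qquad |g(x_0)-f(x_0)|<\delta,\qquad \|J_g(x)-J_g(x_0)\|_F<\delta \ \text{ whenever } |x-x_0|<\eta .$$ For an exhaustion of $\mathbb{R}^d=\bigcup_{n\ge1}R_n$ by compact sets, with $R_n$ contained in the interior of $R_{n+1}$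 for all $n$, put $$\|g\|_{n,\infty}=\max_{x\in R_n}|g(x)|+\Big(\sum_{i,j=1}^d\big(\max_{x\in R_n}|\tfrac{\partial g_i}{\partial x_j}(x)|\big)^2\Big)^{1/2},\qquad \mathsf{d}(f,g)=\sum_{n=1}^\infty 2^{-n}\frac{\|f-g\|_{n,\infty}}{1+\|f-g\|_{n,\infty}}$$ (maxima over the empty set being $0$), and $\mathsf{B}^{\mathsf d}_\varepsilon(f)=\{g\in C^1(\mathbb{R}^d):\mathsf{d}(f,g)<\varepsilon\}$. **Theorem.** Let $K$ be a Cantor set in $\mathbb{R}^d$ and let $g_0\in C^1_{\mathsf{inv}}(\mathbb{R}^d)$. Then there exist $x_0\in K$ and $\delta\in(0,1)$ such that for all sufficiently small $\eta>0$ there is a Cantor set $\widetilde K\subset\mathbb{R}^d$ with $$g(K)\cap\widetilde K\neq\varnothing\qquad\text{for all } g\in\mathcal{G}_{g_0,x_0,\delta,\eta}.$$ Moreover, for every exhaustion $(R_n)$ as above, with associated metric $\mathsf{d}$, there exist $\varepsilon>0$ and a Cantor set $\widehat K\subset\mathbb{R}^d$ such that $$\Big(\bigcap_{g\in\mathsf{B}^{\mathsf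 d}_\varepsilon(g_0)}\big(g(K)+\widehat K\big)\Big)^{\circ}\neq\varnothing .$$ -/

import Mathlib

open scoped Pointwise

/-- A Cantor set in `ℝ^d`: a non-empty compact, totally disconnected and perfect subset. -/
structure IsCantorSet {d : ℕ} (K : Set (EuclideanSpace ℝ (Fin d))) : Prop where
  nonempty : K.Nonempty
  isCompact : IsCompact K
  isTotallyDisconnected : IsTotallyDisconnected K
  perfect : Perfect K

/-- The Jacobian matrix `(∂gᵢ/∂xⱼ)ᵢⱼ` of `g` at `x`. -/
noncomputable def jacobianMatrix {d : ℕ}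
    (g : EuclideanSpace ℝ (Fin d) → EuclideanSpace ℝ (Fin d)) (x : EuclideanSpace ℝ (Fin d)) :
    Matrix (Fin d) (Fin d) ℝ :=
  Matrix.of fun i j => fderiv ℝ g x (EuclideanSpace.single j (1 : ℝ)) i

/-- The Frobenius norm of a square matrix. -/
noncomputable def frobNorm {d : ℕ} (A : Matrix (Fin d) (Fin d) ℝ) : ℝ :=
  Real.sqrt (∑ i, ∑ j, A i j ^ 2)

/-- `C¹_inv(ℝ^d)`: the `C¹` maps whose Jacobian matrix is invertible at all points. -/
def C1Inv (d : ℕ) : Set (EuclideanSpace ℝ (Fin d) → EuclideanSpace ℝ (Fin d)) :=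
  {g | ContDiff ℝ 1 g ∧ ∀ x, IsUnit (jacobianMatrix g x)}

/-- The `C¹` norm of `g` on a compact set `S`: the maximum of `|g|` on `S` plus the Frobenius norm
of the matrix of the maxima on `S` of the absolute values of the partial derivatives of `g`. -/
noncomputable def c1NormOn {d : ℕ} (S : Set (EuclideanSpace ℝ (Fin d)))
    (g : EuclideanSpace ℝ (Fin d) → EuclideanSpace ℝ (Fin d)) : ℝ :=
  (⨆ x : S, ‖g x‖) + frobNorm (Matrix.of fun i j => ⨆ x : S, |jacobianMatrix g x i j|)

/-- The metric of local uniform `C¹` convergence attached to an exhaustion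
`R 0 ⊆ R 1 ⊆ ⋯` of `ℝ^d` by compact sets. The exhaustion is indexed from `0`, so that `R n` has
the weight `2^{-(n+1)}`. -/
noncomputable def c1Dist {d : ℕ} (R : CompactExhaustion (EuclideanSpace ℝ (Fin d)))
    (f g : EuclideanSpace ℝ (Fin d) → EuclideanSpace ℝ (Fin d)) : ℝ :=
  ∑' n : ℕ, (1 / 2 : ℝ) ^ (n + 1) * (c1NormOn (R n) (f - g) / (1 + c1NormOn (R n) (f - g)))

/-- The open ball of radius `ε` around `f` in the metric space `C¹(ℝ^d)`. -/
def c1Ball {d : ℕ} (R : CompactExhaustion (EuclideanSpace ℝ (Fin d)))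
    (f : EuclideanSpace ℝ (Fin d) → EuclideanSpace ℝ (Fin d)) (ε : ℝ) :
    Set (EuclideanSpace ℝ (Fin d) → EuclideanSpace ℝ (Fin d)) :=
  {g | ContDiff ℝ 1 g ∧ c1Dist R f g < ε}

/-- The set `𝒢_{f,x₀,δ,η}`: the `C¹` maps `g` whose value and Jacobian matrix at `x₀` are
`δ`-close to those of `f`, and whose Jacobian matrix oscillates by less than `δ` on the open
ball of radius `η` around `x₀`. -/
def c1Nbhd {d : ℕ} (f : EuclideanSpace ℝ (Fin d) → EuclideanSpace ℝ (Fin d))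
    (x₀ : EuclideanSpace ℝ (Fin d)) (δ η : ℝ) :
    Set (EuclideanSpace ℝ (Fin d) → EuclideanSpace ℝ (Fin d)) :=
  {g | ContDiff ℝ 1 g ∧
    frobNorm (jacobianMatrix g x₀ - jacobianMatrix f x₀) < δ ∧ ‖g x₀ - f x₀‖ < δ ∧
    ∀ x, ‖x - x₀‖ < η → frobNorm (jacobianMatrix g x - jacobianMatrix g x₀) < δ}

/-!
The partner Cantor set is `D ⊆ X`, where `X` is a closed ellipsoid with countably many thin slabs
`{y | |⟪vₙ, A⁻¹ y⟫ - qₙ| < ρₙ}` removed, and `A` is the derivative of `g₀` at `x₀`.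

*Directions.* Finitely many cones `{w | 3/4 ‖w‖ < |⟪u, w⟫|}` with `‖u‖ = 1` cover all nonzero
vectors. Since `K` is perfect, for one of these `u` there is an open set `V` meeting `K` such that
every smaller open set meeting `K` contains two points of `K` whose difference lies in the cone
(`Perfect.exists_common_direction`). The point `x₀` is taken in `K ∩ V`. If `‖v - u‖ ≤ 1/2` and
`A⁻¹ ∘ g` is close to the identity in the Lipschitz sense, which holds for all `g` in the given
neighbourhood of `g₀` by the mean value inequality, then the values of `⟪v, A⁻¹ g ·⟫` at two such
points differ by a definite amount which does not depend on `g` or `v`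
(`le_abs_inner_sub_of_norm_sub_le`).

*Dodging.* Inside every open piece of `K ∩ V` one can therefore find three smaller pieces whose
images under `⟪vₙ, A⁻¹ g ·⟫` are `2ρ`-separated, for all `g` at once. A slab of half-width `ρ` meets
the image of at most one of the three pieces, and a prescribed point lies in the image of at most
one, so some piece avoids both (`exists_child_avoiding`). Iterating gives a ternary tree of pieces;
its `n`-th level is finite, so one `ρₙ > 0` serves the whole level. For each `g` a branch of the
tree leads to a point `x ∈ K` such that `g x` is in no slab and outside any prescribed countable set
(`exists_slab_widths`).

*The Cantor set.* The pairs `(vₙ, qₙ)` are dense in `ball u (1/2) × ℝ`, so any two points are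
separated by a slab and `X` is totally disconnected. By the Cantor–Bendixson theorem `X` is the
union of a countable set and a perfect set `D`; as the countable part can be dodged too, `g '' K`
meets `D` (`exists_isCantorSet_inter_image_nonempty`).

*Sums.* For `g` close to `g₀` in the `C¹` metric, all translates `g - c` by small vectors `c` belong
to the neighbourhood of `g₀`, so `c ∈ g '' K + (-D)`.
-/

open Metric

/-! ### Directions in a perfect set -/

/-- Near some point of a perfect set `K`, every open piece of `K` contains two points whose
difference is roughly parallel to a fixed unit vector `u`. Otherwise, passing to smaller pieces
finitely often would exclude all cones of a finite cover and leave a piece with a single point. -/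
theorem Perfect.exists_common_direction {E : Type*} [NormedAddCommGroup E] [InnerProductSpace ℝ E]
    [FiniteDimensional ℝ E] {K : Set E} (hK : Perfect K) (hne : K.Nonempty) :
    ∃ u : E, ‖u‖ = 1 ∧ ∃ V : Set E, IsOpen V ∧ (K ∩ V).Nonempty ∧
      ∀ W ⊆ V, IsOpen W → (K ∩ W).Nonempty →
        ∃ a ∈ K ∩ W, ∃ b ∈ K ∩ W, 3 / 4 * ‖a - b‖ < |inner ℝ u (a - b)| := by
  by_contra! h
  have key : ∀ s : Finset E, (∀ u ∈ s, ‖u‖ = 1) → ∃ W : Set E, IsOpen W ∧ (K ∩ W).Nonempty ∧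
      ∀ u ∈ s, ∀ a ∈ K ∩ W, ∀ b ∈ K ∩ W, |inner ℝ u (a - b)| ≤ 3 / 4 * ‖a - b‖ := by
    classical
    intro s
    induction s using Finset.induction with
    | empty => exact fun _ => ⟨Set.univ, isOpen_univ, by simpa using hne, by simp⟩
    | insert u s _ ih =>
      intro hs
      obtain ⟨W, hWo, hWne, hW⟩ := ih fun v hv => hs v (Finset.mem_insert_of_mem hv)
      obtain ⟨W', hW'W, hW'o, hW'ne, hW'⟩ := h u (hs u (Finset.mem_insert_self u s)) W hWo hWne
      refine ⟨W', hW'o, hW'ne, fun v hv a ha b hb => ?_⟩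
      rcases Finset.mem_insert.1 hv with rfl | hv
      · exact hW' a ha b hb
      · exact hW v hv a ⟨ha.1, hW'W ha.2⟩ b ⟨hb.1, hW'W hb.2⟩
  obtain ⟨t, hts, ht⟩ := (isCompact_sphere (0 : E) 1).elim_nhds_subcover
    (fun u => {w | 3 / 4 < inner ℝ u w}) fun u hu => by
      refine (isOpen_lt continuous_const (by fun_prop)).mem_nhds ?_
      have : ‖u‖ = 1 := by simpa using hu
      simp only [Set.mem_ofPred_eq, real_inner_self_eq_norm_sq, this]
      norm_num
  obtain ⟨W, hWo, ⟨a, haK, haW⟩, hW⟩ := key t fun u hu => by simpa using hts u hu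
  obtain ⟨b, ⟨hbW, hbK⟩, hba⟩ := accPt_iff_nhds.1 (hK.acc a haK) W (hWo.mem_nhds haW)
  have hpos : 0 < ‖a - b‖ := norm_pos_iff.2 (sub_ne_zero.2 hba.symm)
  have hmem : ‖a - b‖⁻¹ • (a - b) ∈ sphere (0 : E) 1 := by
    simp [norm_smul, hpos.ne']
  obtain ⟨u, hut, hu⟩ := Set.mem_iUnion₂.1 (ht hmem)
  simp only [Set.mem_ofPred_eq, inner_smul_right] at hu
  have h1 := hW u hut a ⟨haK, haW⟩ b ⟨hbK, hbW⟩
  rw [inv_mul_eq_div, lt_div_iff₀ hpos] at hu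
  linarith [le_abs_self (inner ℝ u (a - b))]

/-! ### Dodging slabs along a ternary tree -/

/-- Among three pieces whose images under `ℓ ∘ f` are `2ρ`-separated, at most one meets the slab
`|ℓ - q| < ρ` and at most one has `z` in its image. -/
theorem exists_child_avoiding {E F : Type*} {φ : E → E → ℝ} {C : Fin 3 → Set E} {ρ : ℝ} (hρ : 0 < ρ)
    (hC : ∀ i j, i ≠ j → ∀ x ∈ C i, ∀ y ∈ C j, 2 * ρ ≤ φ x y) (f : E → F) (ℓ : F → ℝ)
    (hf : ∀ i, ∀ x ∈ C i, ∀ j, ∀ y ∈ C j, φ x y ≤ |ℓ (f x) - ℓ (f y)|) (q : ℝ) (z : F) :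
    ∃ i, ∀ x ∈ C i, ρ ≤ |ℓ (f x) - q| ∧ f x ≠ z := by
  have hslab : ∀ i j, i ≠ j → (∃ x ∈ C i, |ℓ (f x) - q| < ρ) →
      ∀ y ∈ C j, ρ ≤ |ℓ (f y) - q| := by
    rintro i j hij ⟨x, hx, hxq⟩ y hy
    have h1 := hC i j hij x hx y hy
    have h2 := hf i x hx j y hy
    have h3 := abs_sub_le (ℓ (f x)) q (ℓ (f y))
    rw [abs_sub_comm q] at h3
    linarith
  have hpt : ∀ i j, i ≠ j → (∃ x ∈ C i, f x = z) → ∀ y ∈ C j, f y ≠ z := by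
    rintro i j hij ⟨x, hx, rfl⟩ y hy hyx
    have h1 := hC i j hij x hx y hy
    have h2 := hf i x hx j y hy
    rw [hyx, sub_self, abs_zero] at h2
    linarith
  -- some index `i` absorbs the slab and some index `j` absorbs the point `z`
  obtain ⟨i, hi⟩ : ∃ i, ∀ k ≠ i, ∀ x ∈ C k, ρ ≤ |ℓ (f x) - q| := by
    by_cases h : ∃ i, ∃ x ∈ C i, |ℓ (f x) - q| < ρ
    · obtain ⟨i, hi⟩ := h
      exact ⟨i, fun k hk => hslab i k hk.symm hi⟩
    · push Not at h
      exact ⟨0, fun k _ => h k⟩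
  obtain ⟨j, hj⟩ : ∃ j, ∀ k ≠ j, ∀ x ∈ C k, f x ≠ z := by
    by_cases h : ∃ i, ∃ x ∈ C i, f x = z
    · obtain ⟨i, hi⟩ := h
      exact ⟨i, fun k hk => hpt i k hk.symm hi⟩
    · push Not at h
      exact ⟨0, fun k _ => h k⟩
  obtain ⟨k, hki, hkj⟩ : ∃ k : Fin 3, k ≠ i ∧ k ≠ j := by
    clear hi hj; revert i j; decide
  exact ⟨k, fun x hx => ⟨hi k hki x hx, hj k hkj x hx⟩⟩

section Tree

variable {E : Type*} [NormedAddCommGroup E] {K V : Set E} {φ : E → E → ℝ}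

/-- Continuity of `φ` spreads a pair of points with `0 < φ a b` to neighbourhoods of both. -/
theorem exists_separated_pair (hφ : Continuous fun p : E × E => φ p.1 p.2)
    (hpair : ∀ W ⊆ V, IsOpen W → (K ∩ W).Nonempty → ∃ a ∈ K ∩ W, ∃ b ∈ K ∩ W, 0 < φ a b)
    {W : Set E} (hWV : W ⊆ V) (hWo : IsOpen W) (hWne : (K ∩ W).Nonempty) :
    ∃ ρ > 0, ∃ W₁ W₂ : Set E, (IsOpen W₁ ∧ (K ∩ W₁).Nonempty ∧ closure W₁ ⊆ W) ∧
      (IsOpen W₂ ∧ (K ∩ W₂).Nonempty ∧ closure W₂ ⊆ W) ∧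
      ∀ x ∈ W₁, ∀ y ∈ W₂, 2 * ρ ≤ φ x y := by
  obtain ⟨a, ⟨haK, haW⟩, b, ⟨hbK, hbW⟩, hab⟩ := hpair W hWV hWo hWne
  have hev : {p : E × E | φ a b / 2 < φ p.1 p.2} ∈ nhds (a, b) :=
    (isOpen_lt continuous_const hφ).mem_nhds (by simpa using hab)
  rw [nhds_prod_eq, Filter.mem_prod_iff] at hev
  obtain ⟨A, hA, B, hB, hAB⟩ := hev
  obtain ⟨r, hr, hrA⟩ := nhds_basis_closedBall.mem_iff.1 (Filter.inter_mem hA (hWo.mem_nhds haW))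
  obtain ⟨s, hs, hsB⟩ := nhds_basis_closedBall.mem_iff.1 (Filter.inter_mem hB (hWo.mem_nhds hbW))
  refine ⟨φ a b / 4, by positivity, ball a r, ball b s,
    ⟨isOpen_ball, ⟨a, haK, mem_ball_self hr⟩,
      fun x hx => (hrA (closure_ball_subset_closedBall hx)).2⟩,
    ⟨isOpen_ball, ⟨b, hbK, mem_ball_self hs⟩,
      fun x hx => (hsB (closure_ball_subset_closedBall hx)).2⟩, fun x hx y hy => ?_⟩
  have : φ a b / 2 < φ x y := hAB (Set.mk_mem_prod (hrA (ball_subset_closedBall hx)).1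
    (hsB (ball_subset_closedBall hy)).1)
  linarith

/-- The third piece comes from splitting one of two separated pieces again. -/
theorem exists_separated_triple (hφ : Continuous fun p : E × E => φ p.1 p.2)
    (hsymm : ∀ x y, φ x y = φ y x)
    (hpair : ∀ W ⊆ V, IsOpen W → (K ∩ W).Nonempty → ∃ a ∈ K ∩ W, ∃ b ∈ K ∩ W, 0 < φ a b)
    {W : Set E} (hWV : W ⊆ V) (hWo : IsOpen W) (hWne : (K ∩ W).Nonempty) :
    ∃ ρ > 0, ∃ C : Fin 3 → Set E,
      (∀ i, IsOpen (C i) ∧ (K ∩ C i).Nonempty ∧ closure (C i) ⊆ W) ∧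
      ∀ i j, i ≠ j → ∀ x ∈ C i, ∀ y ∈ C j, 2 * ρ ≤ φ x y := by
  obtain ⟨ρ, hρ, W₁, W₂, h₁, h₂, h₁₂⟩ := exists_separated_pair hφ hpair hWV hWo hWne
  have h₁W : W₁ ⊆ W := subset_closure.trans h₁.2.2
  obtain ⟨σ, hσ, W₃, W₄, h₃, h₄, h₃₄⟩ :=
    exists_separated_pair hφ hpair (h₁W.trans hWV) h₁.1 h₁.2.1
  have h₃W : W₃ ⊆ W₁ := subset_closure.trans h₃.2.2
  have h₄W : W₄ ⊆ W₁ := subset_closure.trans h₄.2.2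
  have hl := min_le_left ρ σ
  have hr := min_le_right ρ σ
  refine ⟨min ρ σ, lt_min hρ hσ, ![W₂, W₃, W₄], fun i => ?_, fun i j hij x hx y hy => ?_⟩
  · fin_cases i
    · exact h₂
    · exact ⟨h₃.1, h₃.2.1, h₃.2.2.trans h₁W⟩
    · exact ⟨h₄.1, h₄.2.1, h₄.2.2.trans h₁W⟩
  · fin_cases i <;> fin_cases j <;> simp at hij hx hy
    · have := h₁₂ y (h₃W hy) x hx; rw [hsymm]; linarith
    · have := h₁₂ y (h₄W hy) x hx; rw [hsymm]; linarith
    · have := h₁₂ x (h₃W hx) y hy; linarith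
    · have := h₃₄ x hx y hy; linarith
    · have := h₁₂ x (h₄W hx) y hy; linarith
    · have := h₃₄ y hy x hx; rw [hsymm]; linarith

/-- One sequence of slab widths works for all maps `f` whose coordinates `ℓ n ∘ f` separate points
at least as well as `φ`: the image of `K` under `f` has a point outside all slabs
`|ℓ n - q n| < ρ n`, which can moreover be chosen outside any given countable set. -/
theorem exists_slab_widths {F : Type*} (hKc : IsCompact K) (hV : IsOpen V)
    (hne : (K ∩ V).Nonempty) (hφ : Continuous fun p : E × E => φ p.1 p.2)
    (hsymm : ∀ x y, φ x y = φ y x)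
    (hpair : ∀ W ⊆ V, IsOpen W → (K ∩ W).Nonempty → ∃ a ∈ K ∩ W, ∃ b ∈ K ∩ W, 0 < φ a b)
    (ℓ : ℕ → F → ℝ) (q : ℕ → ℝ) :
    ∃ ρ : ℕ → ℝ, (∀ n, 0 < ρ n) ∧ ∀ f : E → F,
      (∀ n, ∀ x ∈ V, ∀ y ∈ V, φ x y ≤ |ℓ n (f x) - ℓ n (f y)|) →
      ∀ Z : Set F, Z.Countable →
        ∃ x ∈ K ∩ V, f x ∉ Z ∧ ∀ n, ρ n ≤ |ℓ n (f x) - q n| := by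
  classical
  let P : Type _ := {W : Set E // W ⊆ V ∧ IsOpen W ∧ (K ∩ W).Nonempty}
  have hstep : ∀ W : P, ∃ ρ : ℝ, ∃ C : Fin 3 → P, 0 < ρ ∧ (∀ i, closure (C i).1 ⊆ W.1) ∧
      ∀ i j, i ≠ j → ∀ x ∈ (C i).1, ∀ y ∈ (C j).1, 2 * ρ ≤ φ x y := by
    rintro ⟨W, hWV, hWo, hWne⟩
    obtain ⟨ρ, hρ, C, hC, hCφ⟩ := exists_separated_triple hφ hsymm hpair hWV hWo hWne
    exact ⟨ρ, fun i => ⟨C i, subset_closure.trans ((hC i).2.2.trans hWV), (hC i).1, (hC i).2.1⟩,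
      hρ, fun i => (hC i).2.2, hCφ⟩
  choose ρ C hρ hCcl hCφ using hstep
  let W₀ : P := ⟨V, subset_rfl, hV, hne⟩
  -- `T n` is the `n`-th level of the tree of pieces
  let T : ℕ → Finset P := fun n =>
    Nat.rec {W₀} (fun _ S => S.biUnion fun W => Finset.univ.image (C W)) n
  have hTsucc : ∀ n, ∀ W ∈ T n, ∀ i, C W i ∈ T (n + 1) := fun n W hW i =>
    Finset.mem_biUnion.2 ⟨W, hW, Finset.mem_image_of_mem _ (Finset.mem_univ i)⟩
  have hTne : ∀ n, (T n).Nonempty := by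
    intro n
    induction n with
    | zero => exact ⟨W₀, Finset.mem_singleton_self W₀⟩
    | succ n ih => exact ⟨_, hTsucc n _ ih.choose_spec 0⟩
  refine ⟨fun n => (T n).inf' (hTne n) ρ, fun n => (Finset.lt_inf'_iff _).2 fun W _ => hρ W,
    fun f hf Z hZ => ?_⟩
  obtain ⟨z, hz⟩ : ∃ z : ℕ → F, Z ⊆ Set.range z := by
    have : Nonempty F := ⟨f hne.choose⟩
    exact Set.countable_iff_exists_subset_range.1 hZ
  have hnext : ∀ (n : ℕ) (W : P), ∃ i, ∀ x ∈ (C W i).1, ρ W ≤ |ℓ n (f x) - q n| ∧ f x ≠ z n :=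
    fun n W => exists_child_avoiding (hρ W) (hCφ W) f (ℓ n)
      (fun i x hx j y hy => hf n x ((C W i).2.1 hx) y ((C W j).2.1 hy)) (q n) (z n)
  choose next hnext using hnext
  -- the branch that dodges the slab `q n` and the point `z n` at level `n`
  let path : ℕ → P := fun n => Nat.rec W₀ (fun n W => C W (next n W)) n
  have hpath : ∀ n, path n ∈ T n := by
    intro n
    induction n with
    | zero => exact Finset.mem_singleton_self W₀
    | succ n ih => exact hTsucc n _ ih _
  have hcl : ∀ n, closure (path (n + 1)).1 ⊆ (path n).1 := fun n => hCcl _ _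
  obtain ⟨x, hx⟩ := IsCompact.nonempty_iInter_of_sequence_nonempty_isCompact_isClosed
    (fun n => K ∩ closure (path n).1)
    (fun n => Set.inter_subset_inter_right K ((hcl n).trans subset_closure))
    (fun n => (path n).2.2.2.mono (Set.inter_subset_inter_right K subset_closure))
    (hKc.inter_right isClosed_closure)
    (fun n => hKc.isClosed.inter isClosed_closure)
  rw [Set.mem_iInter] at hx
  have hxW : ∀ n, x ∈ (path n).1 := fun n => hcl n (hx (n + 1)).2
  refine ⟨x, ⟨(hx 0).1, hxW 0⟩, fun hxZ => ?_, fun n => ?_⟩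
  · obtain ⟨n, hn⟩ := hz hxZ
    exact (hnext n (path n) x (hxW (n + 1))).2 hn.symm
  · exact (Finset.inf'_le ρ (hpath n)).trans (hnext n (path n) x (hxW (n + 1))).1

end Tree

/-! ### The partner Cantor set -/

section Partner

variable {E : Type*} [NormedAddCommGroup E] [InnerProductSpace ℝ E]

theorem exists_inner_ne_zero_of_mem_ball (u : E) {r : ℝ} (hr : 0 < r) {w : E} (hw : w ≠ 0) :
    ∃ v ∈ ball u r, inner ℝ v w ≠ 0 := by
  by_cases h : inner ℝ u w = 0
  · have hw' : 0 < ‖w‖ := norm_pos_iff.2 hw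
    refine ⟨u + (r / 2 / ‖w‖) • w, ?_, ?_⟩
    · rw [mem_ball, dist_eq_norm, add_sub_cancel_left, norm_smul, Real.norm_of_nonneg (by positivity),
        div_mul_cancel₀ _ hw'.ne']
      linarith
    · rw [inner_add_left, h, zero_add, real_inner_smul_left, real_inner_self_eq_norm_sq]
      positivity
  · exact ⟨u, mem_ball_self hr, h⟩

/-- Any two points are on different sides of a slab, because `p` is dense. -/
theorem isTotallyDisconnected_of_forall_le_abs_inner_sub {F : Type*} [TopologicalSpace F]
    {B : F → E} (hB : Continuous B) (hinj : Function.Injective B) {u : E} {r : ℝ} (hr : 0 < r)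
    {p : ℕ → ball u r × ℝ} (hp : DenseRange p) {ρ : ℕ → ℝ} (hρ : ∀ n, 0 < ρ n) {X : Set F}
    (hX : ∀ y ∈ X, ∀ n, ρ n ≤ |inner ℝ ((p n).1 : E) (B y) - (p n).2|) :
    IsTotallyDisconnected X := by
  intro t htX ht y hy y' hy'
  by_contra hne
  obtain ⟨v, hv, hvw⟩ := exists_inner_ne_zero_of_mem_ball u hr
    (sub_ne_zero.2 fun h => hne (hinj h) : B y - B y' ≠ 0)
  have key : ∀ y ∈ t, ∀ y' ∈ t, ¬ inner ℝ v (B y) < inner ℝ v (B y') := by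
    intro y hy y' hy' hlt
    obtain ⟨m, hm⟩ := exists_between hlt
    obtain ⟨n, hn₁, hn₂⟩ := hp.exists_mem_open
      (s := {p : ball u r × ℝ | inner ℝ (p.1 : E) (B y) < p.2 ∧ p.2 < inner ℝ (p.1 : E) (B y')})
      (.and (isOpen_lt (by fun_prop) (by fun_prop)) (isOpen_lt (by fun_prop) (by fun_prop)))
      ⟨(⟨v, hv⟩, m), hm⟩
    obtain ⟨x, hxt, hx⟩ := (ht.image (fun x => inner ℝ ((p n).1 : E) (B x))
      (by fun_prop)).Icc_subset (Set.mem_image_of_mem _ hy) (Set.mem_image_of_mem _ hy')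
      ⟨hn₁.le, hn₂.le⟩
    have h := hX x (htX hxt) n
    simp only at hx
    rw [hx, sub_self, abs_zero] at h
    exact (hρ n).not_ge h
  rw [inner_sub_right, sub_ne_zero] at hvw
  exact hvw.lt_or_gt.elim (key y hy y' hy') (key y' hy' y hy)

/-- If `a - b` is close to `w`, then a vector `v` close to `u` separates `a` from `b` whenever `w`
lies in the cone around `u` of vectors with `3 / 4 * ‖w‖ < |⟪u, w⟫|`. -/
theorem le_abs_inner_sub_of_norm_sub_le {u v a b w : E} (hv : ‖v - u‖ ≤ 1 / 2) (hu : ‖u‖ = 1)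
    (h : ‖(a - b) - w‖ ≤ 1 / 8 * ‖w‖) :
    |inner ℝ u w| - 3 / 4 * ‖w‖ ≤ |inner ℝ v a - inner ℝ v b| := by
  have hv' : ‖v‖ ≤ 3 / 2 := by
    have := norm_le_norm_sub_add v u
    linarith
  have h₁ : |inner ℝ (v - u) w| ≤ 1 / 2 * ‖w‖ :=
    (abs_real_inner_le_norm _ _).trans (by gcongr)
  have h₂ : |inner ℝ v ((a - b) - w)| ≤ 3 / 2 * (1 / 8 * ‖w‖) :=
    (abs_real_inner_le_norm _ _).trans (by gcongr)
  have h₃ : inner ℝ u w = (inner ℝ v a - inner ℝ v b) - inner ℝ (v - u) w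
      - inner ℝ v ((a - b) - w) := by
    simp only [inner_sub_left, inner_sub_right]; ring
  have h₄ : |inner ℝ u w| ≤ |inner ℝ v a - inner ℝ v b| + |inner ℝ (v - u) w|
      + |inner ℝ v ((a - b) - w)| := by
    rw [h₃]
    exact (abs_sub _ _).trans (add_le_add_left (abs_sub _ _) _)
  have := norm_nonneg w
  linarith

end Partner

/-- A single Cantor set meets `f '' K` for all `f` such that `B ∘ f` is close to the identity, in the
Lipschitz sense, and bounded on `V`. -/
theorem exists_isCantorSet_inter_image_nonempty {d : ℕ} {K V : Set (EuclideanSpace ℝ (Fin d))}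
    (hK : IsCantorSet K) (hV : IsOpen V) (hne : (K ∩ V).Nonempty) {u : EuclideanSpace ℝ (Fin d)}
    (hu : ‖u‖ = 1)
    (hdir : ∀ W ⊆ V, IsOpen W → (K ∩ W).Nonempty →
        ∃ a ∈ K ∩ W, ∃ b ∈ K ∩ W, 3 / 4 * ‖a - b‖ < |inner ℝ u (a - b)|)
    (B : EuclideanSpace ℝ (Fin d) ≃L[ℝ] EuclideanSpace ℝ (Fin d)) (M : ℝ) :
    ∃ K' : Set (EuclideanSpace ℝ (Fin d)), IsCantorSet K' ∧
      ∀ f : EuclideanSpace ℝ (Fin d) → EuclideanSpace ℝ (Fin d),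
        (∀ x ∈ V, ∀ y ∈ V, ‖(B (f x) - B (f y)) - (x - y)‖ ≤ 1 / 8 * ‖x - y‖) →
        (∀ x ∈ V, ‖B (f x)‖ ≤ M) → (f '' K ∩ K').Nonempty := by
  have : Nonempty (ball u (1 / 2)) := ⟨⟨u, mem_ball_self (by norm_num)⟩⟩
  let p := TopologicalSpace.denseSeq (ball u (1 / 2) × ℝ)
  obtain ⟨ρ, hρ, hρK⟩ := exists_slab_widths (F := EuclideanSpace ℝ (Fin d))
    (φ := fun x y => |inner ℝ u (x - y)| - 3 / 4 * ‖x - y‖) hK.isCompact hV hne (by fun_prop)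
    (fun x y => by rw [← neg_sub y x, inner_neg_right, abs_neg, norm_neg])
    (by simpa only [sub_pos] using hdir)
    (fun n y => inner ℝ ((p n).1 : EuclideanSpace ℝ (Fin d)) (B y)) (fun n => (p n).2)
  let X : Set (EuclideanSpace ℝ (Fin d)) := B ⁻¹' closedBall 0 M ∩
    ⋂ n, {y | ρ n ≤ |inner ℝ ((p n).1 : EuclideanSpace ℝ (Fin d)) (B y) - (p n).2|}
  have hXclosed : IsClosed X := (isClosed_closedBall.preimage B.continuous).inter
    (isClosed_iInter fun n => isClosed_le continuous_const (by fun_prop))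
  have hXcompact : IsCompact X :=
    (B.toHomeomorph.isCompact_preimage.2 (isCompact_closedBall 0 M)).of_isClosed_subset hXclosed
      Set.inter_subset_left
  have hXdisc : IsTotallyDisconnected X :=
    isTotallyDisconnected_of_forall_le_abs_inner_sub B.continuous B.injective (by norm_num)
      (TopologicalSpace.denseRange_denseSeq _) hρ fun y hy n => Set.mem_iInter.1 hy.2 n
  obtain ⟨Z, D, hZ, hD, hXZD⟩ := exists_countable_union_perfect_of_isClosed hXclosed
  have hDX : D ⊆ X := hXZD ▸ Set.subset_union_right
  have hmeet : ∀ f : EuclideanSpace ℝ (Fin d) → EuclideanSpace ℝ (Fin d),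
      (∀ x ∈ V, ∀ y ∈ V, ‖(B (f x) - B (f y)) - (x - y)‖ ≤ 1 / 8 * ‖x - y‖) →
        (∀ x ∈ V, ‖B (f x)‖ ≤ M) → (f '' K ∩ D).Nonempty := by
    intro f hf hfM
    obtain ⟨x, ⟨hxK, hxV⟩, hxZ, hx⟩ := hρK f (fun n x hx y hy =>
      le_abs_inner_sub_of_norm_sub_le (mem_ball_iff_norm.1 (p n).1.2).le hu (hf x hx y hy)) Z hZ
    have hxX : f x ∈ X := ⟨by simpa using hfM x hxV, Set.mem_iInter.2 hx⟩
    rw [hXZD] at hxX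
    exact ⟨f x, Set.mem_image_of_mem f hxK, hxX.resolve_left hxZ⟩
  rcases D.eq_empty_or_nonempty with hD0 | hDne
  -- if `D` is empty, then no map `f` satisfies the hypotheses
  · exact ⟨K, hK, fun f hf hfM => by simpa [hD0] using hmeet f hf hfM⟩
  · exact ⟨D, ⟨hDne, hXcompact.of_isClosed_subset hD.closed hDX,
      fun t ht => hXdisc t (ht.trans hDX), hD⟩, hmeet⟩

/-! ### Jacobian matrices and the Frobenius norm -/

section Jacobian

variable {d : ℕ}

local notation "𝔼" => EuclideanSpace ℝ (Fin d)

/-- The Jacobian matrix represents the Fréchet derivative in the standard basis. -/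
theorem jacobianMatrix_mulVec (g : 𝔼 → 𝔼) (x w : 𝔼) (i : Fin d) :
    ∑ j, jacobianMatrix g x i j * w j = fderiv ℝ g x w i := by
  conv_rhs => rw [← (EuclideanSpace.basisFun (Fin d) ℝ).sum_repr w]
  simp [jacobianMatrix, map_sum, mul_comm]

theorem jacobianMatrix_sub {f g : 𝔼 → 𝔼} {x : 𝔼} (hf : DifferentiableAt ℝ f x)
    (hg : DifferentiableAt ℝ g x) :
    jacobianMatrix (f - g) x = jacobianMatrix f x - jacobianMatrix g x := by
  ext i j
  simp [jacobianMatrix, fderiv_sub hf hg]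

theorem continuous_jacobianMatrix {g : 𝔼 → 𝔼} (hg : ContDiff ℝ 1 g) :
    Continuous (jacobianMatrix g) := by
  have h := hg.continuous_fderiv one_ne_zero
  refine continuous_matrix fun i j => ?_
  have : Continuous fun x => fderiv ℝ g x (EuclideanSpace.single j 1) := h.clm_apply continuous_const
  exact (EuclideanSpace.proj i).continuous.comp this

theorem continuous_frobNorm : Continuous (frobNorm (d := d)) := by
  unfold frobNorm
  fun_prop

theorem frobNorm_le_of_abs_le {A A' : Matrix (Fin d) (Fin d) ℝ} (h : ∀ i j, |A i j| ≤ A' i j) :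
    frobNorm A ≤ frobNorm A' :=
  Real.sqrt_le_sqrt <| Finset.sum_le_sum fun i _ => Finset.sum_le_sum fun j _ =>
    sq_le_sq' (abs_le.1 (h i j)).1 (abs_le.1 (h i j)).2

theorem frobNorm_neg (A : Matrix (Fin d) (Fin d) ℝ) : frobNorm (-A) = frobNorm A := by
  simp [frobNorm]

section
attribute [local instance] Matrix.frobeniusNormedAddCommGroup

theorem frobNorm_add_le (A A' : Matrix (Fin d) (Fin d) ℝ) :
    frobNorm (A + A') ≤ frobNorm A + frobNorm A' := by
  have h : ∀ A : Matrix (Fin d) (Fin d) ℝ, frobNorm A = ‖A‖ := fun A => by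
    simp [frobNorm, Matrix.frobenius_norm_def, Real.sqrt_eq_rpow]
  simpa only [h] using norm_add_le A A'

end

theorem norm_fderiv_sub_le_frobNorm (f g : 𝔼 → 𝔼) (x y : 𝔼) :
    ‖fderiv ℝ f x - fderiv ℝ g y‖ ≤ frobNorm (jacobianMatrix f x - jacobianMatrix g y) := by
  refine ContinuousLinearMap.opNorm_le_bound _ (Real.sqrt_nonneg _) fun w => ?_
  rw [EuclideanSpace.norm_eq, EuclideanSpace.norm_eq, frobNorm,
    ← Real.sqrt_mul (by positivity), Finset.sum_mul]
  refine Real.sqrt_le_sqrt (Finset.sum_le_sum fun i _ => ?_)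
  have h : (fderiv ℝ f x - fderiv ℝ g y) w i
      = ∑ j, (jacobianMatrix f x - jacobianMatrix g y) i j * w j := by
    simp [← jacobianMatrix_mulVec, sub_mul, Finset.sum_sub_distrib]
  rw [h]
  simpa using Finset.sum_mul_sq_le_sq_mul_sq Finset.univ _ _

theorem exists_continuousLinearEquiv_eq_fderiv {g : 𝔼 → 𝔼} {x : 𝔼}
    (h : IsUnit (jacobianMatrix g x)) : ∃ A : 𝔼 ≃L[ℝ] 𝔼, (A : 𝔼 →L[ℝ] 𝔼) = fderiv ℝ g x := by
  have hinj : Function.Injective (fderiv ℝ g x : 𝔼 →ₗ[ℝ] 𝔼) := by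
    refine (injective_iff_map_eq_zero _).2 fun w hw => ?_
    have hw' : (jacobianMatrix g x).mulVec w.ofLp = 0 := by
      ext i
      have := jacobianMatrix_mulVec g x w i
      simpa [Matrix.mulVec, dotProduct, show fderiv ℝ g x w = 0 from hw] using this
    have := Matrix.mulVec_injective_of_isUnit h (hw'.trans (Matrix.mulVec_zero _).symm)
    exact WithLp.ofLp_injective 2 this
  exact ⟨(LinearEquiv.ofInjectiveEndo _ hinj).toContinuousLinearEquiv, by ext w; rfl⟩

/-! ### The `C¹` metric -/

theorem norm_le_c1NormOn {S : Set 𝔼} (hS : IsCompact S) {g : 𝔼 → 𝔼} (hg : ContDiff ℝ 1 g) {x : 𝔼}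
    (hx : x ∈ S) : ‖g x‖ ≤ c1NormOn S g := by
  have hbdd : BddAbove (Set.range fun x : S => ‖g x‖) := by
    rw [← Set.image_eq_range (fun x => ‖g x‖)]
    exact (hS.image hg.continuous.norm).bddAbove
  exact (le_ciSup hbdd ⟨x, hx⟩).trans (le_add_of_nonneg_right (Real.sqrt_nonneg _))

theorem frobNorm_jacobianMatrix_le_c1NormOn {S : Set 𝔼} (hS : IsCompact S) {g : 𝔼 → 𝔼}
    (hg : ContDiff ℝ 1 g) {x : 𝔼} (hx : x ∈ S) : frobNorm (jacobianMatrix g x) ≤ c1NormOn S g := by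
  refine (frobNorm_le_of_abs_le fun i j => ?_).trans
    (le_add_of_nonneg_left (Real.iSup_nonneg fun _ => norm_nonneg _))
  have hbdd : BddAbove (Set.range fun x : S => |jacobianMatrix g x i j|) := by
    rw [← Set.image_eq_range (fun x => |jacobianMatrix g x i j|)]
    exact (hS.image ((continuous_jacobianMatrix hg).matrix_elem i j).abs).bddAbove
  exact le_ciSup hbdd ⟨x, hx⟩

theorem c1NormOn_nonneg (S : Set 𝔼) (g : 𝔼 → 𝔼) : 0 ≤ c1NormOn S g :=
  add_nonneg (Real.iSup_nonneg fun _ => norm_nonneg _) (Real.sqrt_nonneg _)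

/-- The `n`-th summand alone bounds `c1Dist` from below, and `t ↦ t / (1 + t)` is increasing. -/
theorem c1NormOn_lt_of_c1Dist_lt (R : CompactExhaustion 𝔼) {f g : 𝔼 → 𝔼} {n : ℕ} {τ : ℝ}
    (hτ : 0 < τ) (h : c1Dist R f g < (1 / 2) ^ (n + 1) * (τ / (1 + τ))) :
    c1NormOn (R n) (f - g) < τ := by
  have hN : ∀ n, 0 ≤ c1NormOn (R n) (f - g) := fun n => c1NormOn_nonneg _ _
  have hterm : ∀ n, 0 ≤ (1 / 2 : ℝ) ^ (n + 1) *
      (c1NormOn (R n) (f - g) / (1 + c1NormOn (R n) (f - g))) := fun n => by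
    have := hN n
    positivity
  have hsum : Summable fun n => (1 / 2 : ℝ) ^ (n + 1) *
      (c1NormOn (R n) (f - g) / (1 + c1NormOn (R n) (f - g))) := by
    refine Summable.of_nonneg_of_le hterm (fun n => mul_le_of_le_one_right (by positivity) ?_)
      ((summable_nat_add_iff 1).2 summable_geometric_two)
    have := hN n
    exact div_le_one_of_le₀ (by linarith) (by linarith)
  have hlt := (hsum.le_tsum n fun m _ => hterm m).trans_lt h
  have hlt' := lt_of_mul_lt_mul_left hlt (by positivity)
  have := hN n
  rw [div_lt_div_iff₀ (by linarith) (by linarith)] at hlt'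
  linarith

/-- Small translates of maps near `f` in the `C¹` metric lie in a prescribed `c1Nbhd`, provided its
radius `η` is small enough for the Jacobian of `f` to oscillate little on the ball around `x₀`. -/
theorem exists_forall_mem_c1Ball_sub_const_mem_c1Nbhd (R : CompactExhaustion 𝔼) {f : 𝔼 → 𝔼}
    (hf : ContDiff ℝ 1 f) (x₀ : 𝔼) {δ η₀ : ℝ} (hδ : 0 < δ) (hη₀ : 0 < η₀) :
    ∃ ε > 0, ∃ η, 0 < η ∧ η < η₀ ∧ ∀ g ∈ c1Ball R f ε, ∀ c : 𝔼, ‖c‖ < δ / 2 →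
      (fun x => g x - c) ∈ c1Nbhd f x₀ δ η := by
  have hcont : Continuous fun x => frobNorm (jacobianMatrix f x - jacobianMatrix f x₀) :=
    continuous_frobNorm.comp ((continuous_jacobianMatrix hf).sub continuous_const)
  obtain ⟨r, hr, hrf⟩ := Metric.mem_nhds_iff.1 ((isOpen_lt hcont continuous_const).mem_nhds
    (show frobNorm (jacobianMatrix f x₀ - jacobianMatrix f x₀) < δ / 4 by
      simp only [sub_self, frobNorm]; simpa using hδ))
  obtain ⟨n, hn⟩ := R.exists_superset_of_isCompact (isCompact_closedBall x₀ η₀)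
  refine ⟨(1 / 2) ^ (n + 1) * (δ / 4 / (1 + δ / 4)), by positivity, min r (η₀ / 2),
    lt_min hr (by linarith), (min_le_right _ _).trans_lt (by linarith), ?_⟩
  rintro g ⟨hg, hdist⟩ c hc
  have hlt := c1NormOn_lt_of_c1Dist_lt R (by positivity) hdist
  have hJ : ∀ x, ‖x - x₀‖ ≤ η₀ → frobNorm (jacobianMatrix f x - jacobianMatrix g x) < δ / 4 :=
    fun x hx => by
      rw [← jacobianMatrix_sub (hf.differentiable one_ne_zero x) (hg.differentiable one_ne_zero x)]
      exact (frobNorm_jacobianMatrix_le_c1NormOn (R.isCompact n) (hf.sub hg)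
        (hn (mem_closedBall_iff_norm.2 hx))).trans_lt hlt
  have hJc : jacobianMatrix (fun x => g x - c) = jacobianMatrix g := by
    ext x i j
    simp only [jacobianMatrix, fderiv_sub_const]
  have hJ' : ∀ x, ‖x - x₀‖ ≤ η₀ → frobNorm (jacobianMatrix g x - jacobianMatrix f x) < δ / 4 :=
    fun x hx => by rw [← neg_sub, frobNorm_neg]; exact hJ x hx
  have h₀ : ‖x₀ - x₀‖ ≤ η₀ := by simpa using hη₀.le
  refine ⟨hg.sub contDiff_const, ?_, ?_, fun x hx => ?_⟩
  · rw [hJc]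
    linarith [hJ' x₀ h₀]
  · have hval : ‖f x₀ - g x₀‖ < δ / 4 := (norm_le_c1NormOn (R.isCompact n) (hf.sub hg)
      (hn (mem_closedBall_self hη₀.le))).trans_lt hlt
    rw [norm_sub_rev] at hval
    calc ‖g x₀ - c - f x₀‖ = ‖(g x₀ - f x₀) - c‖ := by rw [sub_right_comm]
      _ ≤ ‖g x₀ - f x₀‖ + ‖c‖ := norm_sub_le _ _
      _ < δ := by linarith
  · have hxr : ‖x - x₀‖ < r := hx.trans_le (min_le_left _ _)
    have hxη : ‖x - x₀‖ ≤ η₀ := by linarith [hx.trans_le (min_le_right r (η₀ / 2))]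
    have h₁ : frobNorm (jacobianMatrix f x - jacobianMatrix f x₀) < δ / 4 :=
      hrf (mem_ball_iff_norm.2 hxr)
    have h₂ : jacobianMatrix g x - jacobianMatrix g x₀
        = (jacobianMatrix g x - jacobianMatrix f x) + (jacobianMatrix f x - jacobianMatrix f x₀)
          + (jacobianMatrix f x₀ - jacobianMatrix g x₀) := by abel
    rw [hJc, h₂]
    have h₃ := frobNorm_add_le ((jacobianMatrix g x - jacobianMatrix f x)
      + (jacobianMatrix f x - jacobianMatrix f x₀)) (jacobianMatrix f x₀ - jacobianMatrix g x₀)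
    have h₄ := frobNorm_add_le (jacobianMatrix g x - jacobianMatrix f x)
      (jacobianMatrix f x - jacobianMatrix f x₀)
    linarith [hJ' x hxη, hJ x₀ h₀]

end Jacobian

/-! ### Intersections and sums with a fixed Cantor set -/

theorem IsCantorSet.neg {d : ℕ} {K : Set (EuclideanSpace ℝ (Fin d))} (hK : IsCantorSet K) :
    IsCantorSet (-K) where
  nonempty := hK.nonempty.neg
  isCompact := hK.isCompact.neg
  isTotallyDisconnected := by
    intro t ht hconn
    have h := hK.isTotallyDisconnected (-t) (by simpa using Set.neg_subset_neg.2 ht)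
      (by simpa using hconn.image Neg.neg continuous_neg.continuousOn)
    exact fun x hx y hy => neg_injective (h (by simpa using hx) (by simpa using hy))
  perfect := by
    refine ⟨hK.perfect.closed.neg, fun x hx => accPt_iff_nhds.2 fun U hU => ?_⟩
    obtain ⟨y, ⟨hyU, hyK⟩, hne⟩ := accPt_iff_nhds.1 (hK.perfect.acc (-x) hx) (-U)
      (continuous_neg.continuousAt.preimage_mem_nhds (by simpa using hU))
    exact ⟨-y, ⟨hyU, by simpa using hyK⟩, fun h => hne (by rw [← h, neg_neg])⟩

/-- The intersection property, valid for every radius `η`. -/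
theorem IsCantorSet.exists_forall_mem_c1Nbhd_inter_nonempty {d : ℕ}
    {K : Set (EuclideanSpace ℝ (Fin d))} (hK : IsCantorSet K)
    {g₀ : EuclideanSpace ℝ (Fin d) → EuclideanSpace ℝ (Fin d)} (hg₀ : g₀ ∈ C1Inv d) :
    ∃ x₀ ∈ K, ∃ δ : ℝ, 0 < δ ∧ δ < 1 ∧ ∀ η : ℝ, 0 < η →
      ∃ K' : Set (EuclideanSpace ℝ (Fin d)), IsCantorSet K' ∧
        ∀ g ∈ c1Nbhd g₀ x₀ δ η, (g '' K ∩ K').Nonempty := by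
  obtain ⟨u, hu, V, hV, ⟨x₀, hx₀K, hx₀V⟩, hdir⟩ := hK.perfect.exists_common_direction hK.nonempty
  obtain ⟨A, hA⟩ := exists_continuousLinearEquiv_eq_fderiv (hg₀.2 x₀)
  set b := ‖(A.symm : EuclideanSpace ℝ (Fin d) →L[ℝ] EuclideanSpace ℝ (Fin d))‖
  have hb0 : 0 ≤ b := norm_nonneg _
  -- the choice of `δ` makes `A⁻¹ ∘ g` have derivative within `1 / 8` of the identity
  have hδb : b * (2 * (1 / (16 * (b + 1)))) ≤ 1 / 8 := by
    rw [mul_one_div, mul_div_assoc', div_le_div_iff₀ (by positivity) (by norm_num)]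
    linarith
  have hδ1 : 1 / (16 * (b + 1)) < 1 := by
    rw [div_lt_one (by positivity)]
    linarith
  have hδ0 : 0 < 1 / (16 * (b + 1)) := by positivity
  refine ⟨x₀, hx₀K, 1 / (16 * (b + 1)), hδ0, hδ1, ?_⟩
  generalize 1 / (16 * (b + 1)) = δ at hδb hδ1 hδ0
  intro η hη
  obtain ⟨K', hK', hmeet⟩ := exists_isCantorSet_inter_image_nonempty (V := V ∩ ball x₀ η) hK
    (hV.inter isOpen_ball) ⟨x₀, hx₀K, hx₀V, mem_ball_self hη⟩ hu
    (fun W hW => hdir W (hW.trans Set.inter_subset_left)) A.symm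
    (‖A.symm (g₀ x₀)‖ + b * δ + 9 / 8 * η)
  refine ⟨K', hK', fun g ⟨hg, hJ₀, hval, hJ⟩ => ?_⟩
  have hfd : ∀ x ∈ ball x₀ η, ‖fderiv ℝ g x - A‖ ≤ 2 * δ := by
    intro x hx
    have h₁ := (norm_fderiv_sub_le_frobNorm g g x x₀).trans_lt (hJ x (mem_ball_iff_norm.1 hx))
    have h₂ := (norm_fderiv_sub_le_frobNorm g g₀ x₀ x₀).trans_lt hJ₀
    rw [hA]
    have := norm_sub_le_norm_sub_add_norm_sub (fderiv ℝ g x) (fderiv ℝ g x₀) (fderiv ℝ g₀ x₀)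
    linarith
  have hnear : ∀ x ∈ ball x₀ η, ∀ y ∈ ball x₀ η,
      ‖(A.symm (g x) - A.symm (g y)) - (x - y)‖ ≤ 1 / 8 * ‖x - y‖ := by
    intro x hx y hy
    have h₁ := (convex_ball x₀ η).norm_image_sub_le_of_norm_fderiv_le'
      (fun z _ => hg.differentiable one_ne_zero z) hfd hy hx
    have h₂ : (A.symm (g x) - A.symm (g y)) - (x - y)
        = (A.symm : EuclideanSpace ℝ (Fin d) →L[ℝ] EuclideanSpace ℝ (Fin d))
          (g x - g y - (A : EuclideanSpace ℝ (Fin d) →L[ℝ] EuclideanSpace ℝ (Fin d)) (x - y)) := by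
      simp [map_sub]
    rw [h₂]
    calc _ ≤ b * (2 * δ * ‖x - y‖) := ContinuousLinearMap.le_opNorm_of_le _ h₁
      _ = b * (2 * δ) * ‖x - y‖ := by ring
      _ ≤ 1 / 8 * ‖x - y‖ := by gcongr
  refine hmeet g (fun x hx y hy => hnear x hx.2 y hy.2) fun x hx => ?_
  have h₁ := hnear x hx.2 x₀ (mem_ball_self hη)
  have h₂ : ‖A.symm (g x₀) - A.symm (g₀ x₀)‖ ≤ b * δ := by
    rw [← map_sub]
    exact ContinuousLinearMap.le_opNorm_of_le
      (A.symm : EuclideanSpace ℝ (Fin d) →L[ℝ] EuclideanSpace ℝ (Fin d)) hval.le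
  have h₃ := mem_ball_iff_norm.1 hx.2
  calc ‖A.symm (g x)‖ = ‖A.symm (g₀ x₀) + (A.symm (g x₀) - A.symm (g₀ x₀))
        + ((A.symm (g x) - A.symm (g x₀) - (x - x₀)) + (x - x₀))‖ := by congr 1; abel
    _ ≤ ‖A.symm (g₀ x₀)‖ + ‖A.symm (g x₀) - A.symm (g₀ x₀)‖
        + (‖A.symm (g x) - A.symm (g x₀) - (x - x₀)‖ + ‖x - x₀‖) :=
      (norm_add_le _ _).trans (add_le_add (norm_add_le _ _) (norm_add_le _ _))
    _ ≤ _ := by linarith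

theorem theorem1p3 {d : ℕ} (K : Set (EuclideanSpace ℝ (Fin d))) (hK : IsCantorSet K)
    (g₀ : EuclideanSpace ℝ (Fin d) → EuclideanSpace ℝ (Fin d)) (hg₀ : g₀ ∈ C1Inv d) :
    (∃ x₀ ∈ K, ∃ δ : ℝ, 0 < δ ∧ δ < 1 ∧ ∃ η₀ : ℝ, 0 < η₀ ∧ ∀ η : ℝ, 0 < η → η < η₀ →
      ∃ K' : Set (EuclideanSpace ℝ (Fin d)), IsCantorSet K' ∧
        ∀ g ∈ c1Nbhd g₀ x₀ δ η, (g '' K ∩ K').Nonempty) ∧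
    (∀ R : CompactExhaustion (EuclideanSpace ℝ (Fin d)),
      ∃ ε : ℝ, 0 < ε ∧ ∃ K'' : Set (EuclideanSpace ℝ (Fin d)), IsCantorSet K'' ∧
        (interior (⋂ g ∈ c1Ball R g₀ ε, (g '' K + K''))).Nonempty) := by
  obtain ⟨x₀, hx₀, δ, hδ, hδ1, h⟩ := hK.exists_forall_mem_c1Nbhd_inter_nonempty hg₀
  refine ⟨⟨x₀, hx₀, δ, hδ, hδ1, 1, one_pos, fun η hη _ => h η hη⟩, fun R => ?_⟩
  obtain ⟨ε, hε, η, hη, -, hsub⟩ :=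
    exists_forall_mem_c1Ball_sub_const_mem_c1Nbhd R hg₀.1 x₀ hδ one_pos
  obtain ⟨K', hK', hmeet⟩ := h η hη
  refine ⟨ε, hε, -K', hK'.neg, 0, mem_interior.2 ⟨ball 0 (δ / 2), fun c hc => ?_, isOpen_ball,
    mem_ball_self (by positivity)⟩⟩
  refine Set.mem_iInter₂.2 fun g hg => ?_
  -- a point of `(g - c) '' K ∩ K'` writes `c` as a difference of points of `g '' K` and `K'`
  obtain ⟨_, ⟨x, hxK, rfl⟩, hx⟩ := hmeet _ (hsub g hg c (mem_ball_zero_iff.1 hc))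
  exact ⟨g x, Set.mem_image_of_mem g hxK, -(g x - c), Set.neg_mem_neg.2 hx, by simp⟩
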